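/- Let $\mathcal Q$ be the set of prime powers $q=p^n$ ($p$ prime, $n\ge 1$). Let $\mathcal S\subset\mathbb Z[q]$ be the saturated multiplicative system generated by the polynomials $q^n-q$ for $n>1$, and let $\mathsf R=\mathcal S^{-1}\mathbb Z[q]$. Elements of $\mathcal S$ do not vanish on $\mathcal Q$, so $\mathsf R$ acts on functions $\mathcal Q\to\mathbb Q$ by multiplication by values. For a finite simple graph $G$ with vertex set $V$, let $[Z_G]:\mathcal Q\to\mathbb Q$ be the function whose value at $q$ is the number of nondegenerate symmetric $V\times V$ matrices $M$ over $\mathbb F_q$ such that $M_{vw}=0$ whenever $v$ and $w$ are joined by an edge of $G$. For integers $s,r,k\ge 0$ let $[A_G(s,r,k)]:\mathcal Q\to\mathbb Q$ be the function whose value at $q$ is the number of pairs $(Q,f)$ consisting of a symmetric bilinear form $Q$ of rank $r$ on $\mathbb F_q^s$ and a function $f:V\to\mathbb F_q^s$ whose values span a subspace of dimension $k$, such that $Q(f(v),f(w))=0$ whenever $v$ and $w$ are joined by an edge of $G$. Let $M(G)$ be the $\mathsf R$-module spanned by the functions $[A_G(s,r,k)]$ for all $s,r,k\ge 0$, let $DG$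 be the graph obtained from $G$ by adding one disjoint vertex, and let $\mathrm{Graphs}_*$ be the $\mathsf R$-module spanned by the functions $[Z_H]$ for all finite simple graphs $H$. Theorem. For every finite simple graph $G$, $M(G)$ is equal to the $\mathsf R$-module spanned by the functions $[Z_{D^kG}]$ for $k\ge 0$. In particular, $M(G)\subset\mathrm{Graphs}_*$. -/

import Mathlib

universe u

namespace GraphModules

noncomputable section

/-! ### Functions on prime powers and the coefficient ring -/

/-- The set of prime powers `q = p ^ n`, `n ≥ 1`. -/
abbrev PrimePower : Type := {q : ℕ // IsPrimePow q}

instance fact_minFac_prime (q : PrimePower) : Fact q.1.minFac.Prime :=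
  ⟨Nat.minFac_prime q.2.ne_one⟩

/-- The finite field with `q` elements. -/
abbrev Fq (q : PrimePower) : Type :=
  GaloisField q.1.minFac (q.1.factorization q.1.minFac)

theorem card_Fq (q : PrimePower) : Nat.card (Fq q) = q.1 := by
  have h := q.2.minFac_pow_factorization_eq
  rw [GaloisField.card _ _ ?_, h]
  intro h0
  rw [h0, pow_zero] at h
  exact q.2.ne_one h.symm

/-- The ring of functions from the set of prime powers to `ℚ`. -/
abbrev CountFun : Type := PrimePower → ℚ

/-- The saturated multiplicative system in `ℤ[q]` generated by the `q ^ n - q`, `n > 1`. -/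
def S : Submonoid (Polynomial ℤ) :=
  (Submonoid.closure {f : Polynomial ℤ |
    ∃ n : ℕ, 1 < n ∧ f = Polynomial.X ^ n - Polynomial.X}).saturation.toSubmonoid

/-- The ring `R = S⁻¹ ℤ[q]`. -/
abbrev R : Type := Localization S

/-- A polynomial in `ℤ[q]` regarded as a function on prime powers. -/
def evalHom : Polynomial ℤ →+* CountFun :=
  RingHom.pi fun q => Polynomial.eval₂RingHom (Int.castRingHom ℚ) (q.1 : ℚ)

/-- The elements of `S` do not vanish on prime powers. -/
theorem isUnit_evalHom (f : S) : IsUnit (evalHom f) := by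
  obtain ⟨f, hf⟩ := f
  obtain ⟨g, hg⟩ := Submonoid.mem_saturation_iff.mp hf
  have key : ∀ h ∈ Submonoid.closure {f : Polynomial ℤ |
      ∃ n : ℕ, 1 < n ∧ f = Polynomial.X ^ n - Polynomial.X}, IsUnit (evalHom h) := by
    intro h hh
    induction hh using Submonoid.closure_induction with
    | one => simp
    | mul x y _ _ hx hy => rw [map_mul]; exact hx.mul hy
    | mem x hx =>
      obtain ⟨n, hn, rfl⟩ := hx
      rw [Pi.isUnit_iff]
      intro q
      have h1 : (1 : ℚ) < (q.1 : ℚ) := by exact_mod_cast q.2.one_lt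
      have h2 : (q.1 : ℚ) < (q.1 : ℚ) ^ n := by
        simpa using pow_lt_pow_right₀ h1 hn
      have h3 : evalHom (Polynomial.X ^ n - Polynomial.X) q = (q.1 : ℚ) ^ n - q.1 := by
        simp [evalHom]
      rw [h3]
      exact (sub_pos.mpr h2).ne'.isUnit
  have := key _ hg
  rw [map_mul] at this
  exact isUnit_of_mul_isUnit_left this

/-- An element of `R`, regarded as a function on prime powers. -/
def evalR : R →+* CountFun := IsLocalization.lift (M := S) isUnit_evalHom

/-- `R` acts on functions on prime powers by `(a / s • F) q = a(q) / s(q) * F q`. -/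
instance algebraCountFun : Algebra R CountFun := evalR.toAlgebra

/-! ### Graphs and their counting functions -/

/-- A finite simple graph. -/
structure FinSimpleGraph where
  V : Type u
  [fintypeV : Fintype V]
  graph : SimpleGraph V

attribute [instance] FinSimpleGraph.fintypeV

/-- `D G`: the graph obtained from `G` by adding one disjoint vertex. -/
def D (G : FinSimpleGraph.{u}) : FinSimpleGraph.{u} where
  V := Option G.V
  graph := G.graph.map Function.Embedding.some

/-- The `K`-points of `Z_G`: symmetric nondegenerate matrices, with rows and columns indexed by
the vertices of `G`, whose `(v, w)` entry is zero whenever `v` and `w` are joined by an edge. -/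
def ZPoints (G : FinSimpleGraph.{u}) (K : Type) [Field K] : Set (Matrix G.V G.V K) :=
  {M | M.IsSymm ∧ M.rank = Fintype.card G.V ∧ ∀ v w, G.graph.Adj v w → M v w = 0}

/-- The `K`-points of `A_G(s, r, k)`: pairs `(Q, f)` where `Q` is a symmetric bilinear form of
rank `r` on `K ^ s` and `f` is a function from the vertices of `G` to `K ^ s` whose span has
dimension `k`, such that `Q (f v) (f w) = 0` whenever `v` and `w` are joined by an edge. -/
def APoints (G : FinSimpleGraph.{u}) (s r k : ℕ) (K : Type) [Field K] :
    Set (LinearMap.BilinForm K (Fin s → K) × (G.V → Fin s → K)) :=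
  {x | x.1.IsSymm ∧ Module.finrank K (LinearMap.range x.1) = r ∧
    Module.finrank K (Submodule.span K (Set.range x.2)) = k ∧
    ∀ v w, G.graph.Adj v w → x.1 (x.2 v) (x.2 w) = 0}

/-- `[Z_G]`: the function `q ↦ #Z_G(𝔽_q)`. -/
def countZ (G : FinSimpleGraph.{u}) : CountFun :=
  fun q => (Nat.card (ZPoints G (Fq q)) : ℚ)

/-- `[A_G(s, r, k)]`: the function `q ↦ #A_G(s, r, k)(𝔽_q)`. -/
def countA (G : FinSimpleGraph.{u}) (s r k : ℕ) : CountFun :=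
  fun q => (Nat.card (APoints G s r k (Fq q)) : ℚ)

/-- `M(G)`: the `R`-module generated by all the `[A_G(s, r, k)]`. -/
def M (G : FinSimpleGraph.{u}) : Submodule R CountFun :=
  Submodule.span R {F | ∃ s r k : ℕ, F = countA G s r k}

/-- `Graphs_*`: the `R`-module generated by the `[Z_H]` for all finite simple graphs `H`. -/
def GraphsStar : Submodule R CountFun :=
  Submodule.span R (Set.range countZ.{u})

end

end GraphModules

/-!
Send a pair `(Q, f)`, with `F` the matrix whose rows are the vectors `f v`, to the symmetric matrix
`P = F * Q * Fᵀ`. The edge condition on `(Q, f)` says exactly that `P` vanishes on the edges of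
`G`, and the number of pairs above `P` is a polynomial in `q` depending only on the rank of `P`: the
columns of `F` must span a space containing the columns of `P`, and after a change of basis that
kills all but `k` of the columns of `F`, the form `Q` runs over the symmetric extensions of a
prescribed `k × k` block of the same rank as `P`. Likewise a symmetric matrix for `D G` is an
arbitrary bordering of one for `G`, and the number of borderings of given rank depends only on the
rank. So both families of functions are combinations of the numbers `N_t` of symmetric matrices of
rank `t` that vanish on the edges of `G`.

Both systems are triangular with diagonal coefficients in `S`, so they can be inverted over `R`:
a matrix of rank `t` and size `n` has `q * (q ^ n - q ^ t)` borderings of rank `t + 2`, and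
none arise from a smaller rank, while `[A_G(t, t, t)]` is `N_t` times the order of `GL_t`.
-/

namespace GraphModules

open Polynomial Matrix Module

section Counting

variable {α β τ A : Type*} [Finite α] [Finite β]

theorem ncard_eq_sum_ncard_fiber {B : Type*} [Fintype B] (s : Set α) (g : α → B) :
    s.ncard = ∑ b, {a ∈ s | g a = b}.ncard := by
  classical
  cases nonempty_fintype α
  simp only [Set.ncard_eq_toFinset_card']
  rw [Finset.card_eq_sum_card_fiberwise (f := g) (t := Finset.univ) fun _ _ => Finset.mem_univ _]
  refine Finset.sum_congr rfl fun b _ => congrArg Finset.card ?_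
  ext a
  simp

theorem ncard_eq_sum_of_ncard_fiber_eq [Semiring A] {s : Set α} {t : Set β} {g : α → β}
    (hg : Set.MapsTo g s t) {ρ : β → τ} {T : Finset τ} (hρ : Set.MapsTo ρ t T) {c : τ → A}
    (h : ∀ b ∈ t, ({a ∈ s | g a = b}.ncard : A) = c (ρ b)) :
    (s.ncard : A) = ∑ i ∈ T, ({b ∈ t | ρ b = i}.ncard : A) * c i := by
  classical
  cases nonempty_fintype α
  cases nonempty_fintype β
  simp only [Set.ncard_eq_toFinset_card'] at h ⊢
  have hg' : (s.toFinset : Set α).MapsTo g t.toFinset := by simpa using hg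
  have hρ' : ∀ b ∈ t.toFinset, ρ b ∈ T := fun b hb => hρ (Set.mem_toFinset.1 hb)
  rw [Finset.card_eq_sum_card_fiberwise hg', Nat.cast_sum, ← Finset.sum_fiberwise_of_maps_to hρ']
  refine Finset.sum_congr rfl fun i _ => ?_
  rw [← nsmul_eq_mul, ← Finset.sum_const]
  refine Finset.sum_congr (by ext; simp) fun b hb => ?_
  obtain ⟨hbt, rfl⟩ := Set.mem_toFinset.1 hb
  rw [← h b hbt]
  congr 2
  ext
  simp

theorem ncard_eq_ncard_mul_of_ncard_fiber_eq [Semiring A] {s : Set α} {t : Set β} {g : α → β}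
    (hg : Set.MapsTo g s t) {c : A} (h : ∀ b ∈ t, ({a ∈ s | g a = b}.ncard : A) = c) :
    (s.ncard : A) = t.ncard * c := by
  simpa using ncard_eq_sum_of_ncard_fiber_eq hg (ρ := fun _ => ()) (T := Finset.univ)
    (c := fun _ => c) (fun _ _ => Finset.mem_coe.2 (Finset.mem_univ _)) h

theorem sum_eq_of_const_on_flag {K E : Type*} [Field K] [AddCommGroup E] [Module K E]
    [FiniteDimensional K E] [Finite K] [Fintype E] [Ring A] {U W : Submodule K E} (hUW : U ≤ W)
    {g : E → A} {a b c : A} (hU : ∀ v ∈ U, g v = a) (hW : ∀ v ∈ W, v ∉ U → g v = b)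
    (hE : ∀ v ∉ W, g v = c) :
    ∑ v, g v = (Nat.card K : A) ^ finrank K U * a +
      ((Nat.card K : A) ^ finrank K W - (Nat.card K : A) ^ finrank K U) * b +
      ((Nat.card K : A) ^ finrank K E - (Nat.card K : A) ^ finrank K W) * c := by
  classical
  have sum_indicator (V : Submodule K E) (x : A) :
      ∑ v, (if v ∈ V then x else 0) = (Nat.card K : A) ^ finrank K V * x := by
    rw [← Nat.cast_pow, ← Module.natCard_eq_pow_finrank (K := K) (V := V), Finset.sum_ite]
    simp [Fintype.card_subtype]
  have g_eq (v : E) : g v = (if v ∈ U then a - b else 0) + (if v ∈ W then b - c else 0) +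
      (if v ∈ (⊤ : Submodule K E) then c else 0) := by
    by_cases hvU : v ∈ U
    · simp [hvU, hUW hvU, hU]
    · by_cases hvW : v ∈ W <;> simp [hvU, hvW, hW, hE]
  simp only [g_eq, Finset.sum_add_distrib, sum_indicator, finrank_top]
  noncomm_ring

end Counting

section Border

variable {K ι : Type*}

/-- The symmetric bordering of `A` by the vector `b` with corner entry `c`. The new index is `none`,
matching the vertex set of `D G`. -/
def border (A : Matrix ι ι K) (b : ι → K) (c : K) : Matrix (Option ι) (Option ι) K
  | some i, some j => A i j
  | some i, none => b i
  | none, some j => b j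
  | none, none => c

theorem isSymm_border {A : Matrix ι ι K} (hA : A.IsSymm) (b : ι → K) (c : K) :
    (border A b c).IsSymm := by
  ext i j
  cases i <;> cases j <;> simp [border, hA.apply]

theorem border_submatrix {M : Matrix (Option ι) (Option ι) K} (hM : M.IsSymm) :
    border (M.submatrix some some) (fun i => M (some i) none) (M none none) = M := by
  ext i j
  cases i <;> cases j <;> simp [border, hM.apply]

theorem transpose_submatrix_border {A : Matrix ι ι K} (hA : A.IsSymm) (b : ι → K) (c : K) :
    ((border A b c).submatrix id some)ᵀ.submatrix id some = A := by
  ext i j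
  exact hA.apply i j

theorem range_col_option {m n : Type*} (X : Matrix m (Option n) K) :
    Set.range X.col = insert (X.col none) (Set.range (X.submatrix id some).col) := by
  ext v
  simp only [Set.mem_range, Option.exists, Set.mem_insert_iff]
  exact or_congr eq_comm Iff.rfl

variable [Field K]

theorem mem_span_range_col_iff {m n : Type*} [Fintype n] {A : Matrix m n K} {b : m → K} :
    b ∈ Submodule.span K (Set.range A.col) ↔ ∃ x, A *ᵥ x = b := by
  rw [← range_mulVecLin]
  rfl

theorem rank_eq_rank_submatrix_some {m n : Type*} [Fintype n]
    {X : Matrix m (Option n) K} (h : ∃ x, X.submatrix id some *ᵥ x = X.col none) :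
    X.rank = (X.submatrix id some).rank := by
  rw [rank_eq_finrank_span_cols, rank_eq_finrank_span_cols, range_col_option,
    Submodule.span_insert_eq_span (mem_span_range_col_iff.2 h)]

theorem rank_eq_rank_submatrix_some_add_one {m n : Type*} [Finite m] [Fintype n]
    {X : Matrix m (Option n) K} (h : ¬∃ x, X.submatrix id some *ᵥ x = X.col none) :
    X.rank = (X.submatrix id some).rank + 1 := by
  rw [rank_eq_finrank_span_cols, rank_eq_finrank_span_cols, range_col_option,
    Submodule.span_insert, sup_comm,
    Submodule.finrank_sup_span_singleton (mt mem_span_range_col_iff.1 h)]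

variable [Fintype ι]

theorem exists_mulVec_eq_col_border_iff {A : Matrix ι ι K} {b : ι → K} {c : K} :
    (∃ x, (border A b c).submatrix id some *ᵥ x = (border A b c).col none) ↔
      ∃ x, A *ᵥ x = b ∧ b ⬝ᵥ x = c := by
  refine exists_congr fun x => ?_
  rw [funext_iff, Option.forall, funext_iff, and_comm]
  rfl

theorem rank_border_mulVec [DecidableEq K] {A : Matrix ι ι K} (hA : A.IsSymm) (x : ι → K) (c : K) :
    (border A (A *ᵥ x) c).rank = if c = A *ᵥ x ⬝ᵥ x then A.rank else A.rank + 1 := by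
  have rank_rows : ((border A (A *ᵥ x) c).submatrix id some).rank = A.rank := by
    rw [← rank_transpose, rank_eq_rank_submatrix_some, transpose_submatrix_border hA]
    exact ⟨x, by rw [transpose_submatrix_border hA]; rfl⟩
  have corner_iff : (∃ y, A *ᵥ y = A *ᵥ x ∧ A *ᵥ x ⬝ᵥ y = c) ↔ c = A *ᵥ x ⬝ᵥ x := by
    refine ⟨?_, fun h => ⟨x, rfl, h.symm⟩⟩
    rintro ⟨y, hy, rfl⟩
    calc A *ᵥ x ⬝ᵥ y = x ᵥ* A ⬝ᵥ y := by rw [← mulVec_transpose, hA.eq]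
      _ = A *ᵥ x ⬝ᵥ x := by rw [← dotProduct_mulVec, hy, dotProduct_comm]
  split_ifs with h <;> rw [← corner_iff, ← exists_mulVec_eq_col_border_iff] at h
  · rw [rank_eq_rank_submatrix_some h, rank_rows]
  · rw [rank_eq_rank_submatrix_some_add_one h, rank_rows]

theorem rank_border_of_notMem {A : Matrix ι ι K} (hA : A.IsSymm) {b : ι → K}
    (hb : b ∉ Submodule.span K (Set.range A.col)) (c : K) :
    (border A b c).rank = A.rank + 2 := by
  rw [mem_span_range_col_iff] at hb
  have no_corner : ¬∃ x, A *ᵥ x = b ∧ b ⬝ᵥ x = c := fun ⟨x, hx, _⟩ => hb ⟨x, hx⟩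
  rw [← exists_mulVec_eq_col_border_iff] at no_corner
  rw [rank_eq_rank_submatrix_some_add_one no_corner, ← rank_transpose,
    rank_eq_rank_submatrix_some_add_one, transpose_submatrix_border hA]
  rw [transpose_submatrix_border hA]
  exact hb

/-- The number of symmetric borderings of rank `r` of a symmetric `n × n` matrix of rank `t`, as a
polynomial in the order of the field. -/
noncomputable def borderCount (n t r : ℕ) : ℤ[X] :=
  X ^ t * (if r = t then 1 else if r = t + 1 then X - 1 else 0) +
    (X ^ n - X ^ t) * (if r = t + 2 then X else 0)

theorem borderCount_add_two (n t : ℕ) : borderCount n t (t + 2) = (X ^ n - X ^ t) * X := by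
  simp [borderCount]

theorem borderCount_eq_zero {n t r : ℕ} (h : t + 2 < r) : borderCount n t r = 0 := by
  rw [borderCount, if_neg (by omega), if_neg (by omega), if_neg (by omega), mul_zero, mul_zero,
    add_zero]

variable [Finite K]

theorem ncard_rank_border_mulVec {A : Matrix ι ι K} (hA : A.IsSymm) (x : ι → K) (r : ℕ) :
    ({c | (border A (A *ᵥ x) c).rank = r}.ncard : ℤ) =
      if r = A.rank then 1 else if r = A.rank + 1 then (Nat.card K : ℤ) - 1 else 0 := by
  classical
  simp only [rank_border_mulVec hA]
  split_ifs with h₀ h₁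
  · simp [h₀]
  · simpa [h₁, Set.compl_def, Nat.cast_pred Nat.card_pos] using
      congrArg (Nat.cast : ℕ → ℤ) (Set.ncard_compl {A *ᵥ x ⬝ᵥ x})
  · have : ∀ c, (if c = A *ᵥ x ⬝ᵥ x then A.rank else A.rank + 1) ≠ r := by
      intro c
      split_ifs <;> omega
    simp [this]

theorem ncard_rank_border {A : Matrix ι ι K} (hA : A.IsSymm) (r : ℕ) :
    ({x : (ι → K) × K | (border A x.1 x.2).rank = r}.ncard : ℤ) =
      (borderCount (Fintype.card ι) A.rank r).eval (Nat.card K : ℤ) := by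
  classical
  cases nonempty_fintype K
  have fiber (b : ι → K) : {x ∈ {x : (ι → K) × K | (border A x.1 x.2).rank = r} | x.1 = b}.ncard =
      {c | (border A b c).rank = r}.ncard := by
    rw [← (Prod.mk_right_injective b).injOn.ncard_image (s := {c | (border A b c).rank = r})]
    congr 1
    ext ⟨b', c⟩
    simp only [Set.mem_ofPred_eq, Set.mem_image, Prod.mk.injEq]
    grind
  rw [ncard_eq_sum_ncard_fiber _ Prod.fst, Nat.cast_sum]
  simp only [fiber]
  rw [sum_eq_of_const_on_flag (U := Submodule.span K (Set.range A.col)) le_top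
    (a := if r = A.rank then 1 else if r = A.rank + 1 then (Nat.card K : ℤ) - 1 else 0)
    (b := if r = A.rank + 2 then (Nat.card K : ℤ) else 0) (c := 0)]
  · rw [finrank_top, finrank_fintype_fun_eq_card, ← rank_eq_finrank_span_cols, borderCount]
    simp only [eval_add, eval_mul, eval_sub, eval_pow, eval_X, apply_ite (eval _), eval_one,
      eval_zero, mul_zero, add_zero]
  · intro b hb
    obtain ⟨x, rfl⟩ := mem_span_range_col_iff.1 hb
    exact ncard_rank_border_mulVec hA x r
  · intro b _ hb
    simp only [rank_border_of_notMem hA hb, eq_comm (a := r)]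
    split_ifs with h <;> simp [h]
  · exact fun v hv => absurd Submodule.mem_top hv

end Border

section SymmOfRank

variable {ι K : Type*} [Fintype ι] [Field K]

variable (ι K) in
/-- The symmetric matrices of rank `r` over `K`, with rows and columns indexed by `ι`. -/
def symmOfRank (r : ℕ) : Set (Matrix ι ι K) :=
  {A | A.IsSymm ∧ A.rank = r}

variable [Finite K]

theorem ncard_eq_sum_ncard_symmOfRank {α : Type*} [Finite α] {s : Set α} {𝒳 : Set (Matrix ι ι K)}
    {g : α → Matrix ι ι K} (hg : ∀ a ∈ s, (g a).IsSymm ∧ g a ∈ 𝒳) {c : ℕ → ℤ}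
    (h : ∀ A ∈ 𝒳, A.IsSymm → ({a ∈ s | g a = A}.ncard : ℤ) = c A.rank) :
    (s.ncard : ℤ) =
      ∑ t ∈ Finset.range (Fintype.card ι + 1), ((symmOfRank ι K t ∩ 𝒳).ncard : ℤ) * c t := by
  rw [ncard_eq_sum_of_ncard_fiber_eq (t := {A : Matrix ι ι K | A.IsSymm ∧ A ∈ 𝒳}) (g := g) hg
    (ρ := Matrix.rank) (T := Finset.range (Fintype.card ι + 1))
    (fun A _ => by simpa using A.rank_le_card_width) (fun A hA => h A hA.2 hA.1)]
  refine Finset.sum_congr rfl fun t _ => ?_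
  congr 3
  ext A
  exact and_right_comm

theorem ncard_symmOfRank_option (𝒳 : Set (Matrix ι ι K)) (r : ℕ) :
    ((symmOfRank (Option ι) K r ∩ {M | M.submatrix some some ∈ 𝒳}).ncard : ℤ) =
      ∑ t ∈ Finset.range (Fintype.card ι + 1), ((symmOfRank ι K t ∩ 𝒳).ncard : ℤ) *
        (borderCount (Fintype.card ι) t r).eval (Nat.card K : ℤ) := by
  refine ncard_eq_sum_ncard_symmOfRank (c := fun t => (borderCount _ t r).eval (Nat.card K : ℤ))
    (fun M hM => ⟨hM.1.1.submatrix some, hM.2⟩) fun A hA𝒳 hA => ?_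
  rw [← ncard_rank_border hA]
  refine congrArg Nat.cast (Set.InvOn.bijOn (f := fun M => (fun i => M (some i) none, M none none))
    (f' := fun x => border A x.1 x.2) ⟨?_, fun _ _ => rfl⟩ ?_ ?_).ncard_eq
  · rintro M ⟨⟨⟨hM, -⟩, -⟩, rfl⟩
    exact border_submatrix hM
  · rintro M ⟨⟨⟨hM, hMr⟩, -⟩, rfl⟩
    exact (congrArg Matrix.rank (border_submatrix hM)).trans hMr
  · exact fun x hx => ⟨⟨⟨isSymm_border hA _ _, hx⟩, hA𝒳⟩, rfl⟩

end SymmOfRank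

section Extension

theorem ncard_symmOfRank_reindex {K m n : Type*} [Field K] [Fintype m] [Fintype n] (e : m ≃ n)
    (𝒳 : Set (Matrix m m K)) (r : ℕ) :
    (symmOfRank m K r ∩ 𝒳).ncard = (symmOfRank n K r ∩ {M | M.submatrix e e ∈ 𝒳}).ncard := by
  refine (Set.InvOn.bijOn (f' := fun M => M.submatrix e e)
    ⟨fun M _ => ?_, fun M _ => ?_⟩ (f := fun M => M.submatrix e.symm e.symm) ?_ ?_).ncard_eq
  · simp
  · simp
  · rintro M ⟨⟨hM, hMr⟩, hM𝒳⟩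
    exact ⟨⟨hM.submatrix _, by rwa [rank_submatrix]⟩, by simpa using hM𝒳⟩
  · rintro M ⟨⟨hM, hMr⟩, hM𝒳⟩
    exact ⟨⟨hM.submatrix _, by rwa [rank_submatrix]⟩, hM𝒳⟩

/-- The equivalence adding to `ι` one further element of `Fin (j + 1)`, matched with `none`, which
reduces an extension by `j + 1` rows and columns to a single bordering. -/
def sumFinSuccEquivOption (ι : Type*) (j : ℕ) : ι ⊕ Fin (j + 1) ≃ Option (ι ⊕ Fin j) :=
  ((Equiv.refl ι).sumCongr (finSuccEquivLast.trans (Equiv.optionEquivSumPUnit (Fin j)))).trans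
    ((Equiv.sumAssoc ι (Fin j) PUnit.{1}).symm.trans (Equiv.optionEquivSumPUnit _).symm)

/-- The number of symmetric matrices of size `k + j` and rank `r` that extend a given symmetric
`k × k` matrix of rank `t`, as a polynomial in the order of the field. -/
noncomputable def extensionCount (k t : ℕ) : ℕ → ℕ → ℤ[X]
  | 0, r => if t = r then 1 else 0
  | j + 1, r => ∑ i ∈ Finset.range (k + j + 1), extensionCount k t j i * borderCount (k + j) i r

theorem ncard_symmOfRank_extension {K ι : Type*} [Field K] [Finite K] [Fintype ι]
    {A : Matrix ι ι K} (hA : A.IsSymm) (j r : ℕ) :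
    ((symmOfRank (ι ⊕ Fin j) K r ∩
        {M : Matrix (ι ⊕ Fin j) (ι ⊕ Fin j) K | M.toBlocks₁₁ = A}).ncard : ℤ) =
      (extensionCount (Fintype.card ι) A.rank j r).eval (Nat.card K : ℤ) := by
  classical
  induction j generalizing r with
  | zero =>
    have extension_eq : symmOfRank ι K r ∩
        {M | M.submatrix (Equiv.sumEmpty ι (Fin 0)) (Equiv.sumEmpty ι (Fin 0)) ∈
          {M | M.toBlocks₁₁ = A}} = if A.rank = r then {A} else ∅ := by
      ext M
      have : M.submatrix (Equiv.sumEmpty ι (Fin 0)) (Equiv.sumEmpty ι (Fin 0)) ∈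
          {M | M.toBlocks₁₁ = A} ↔ M = A := Iff.rfl
      split_ifs with hr <;> simp [symmOfRank] <;> grind
    rw [ncard_symmOfRank_reindex (Equiv.sumEmpty ι (Fin 0)), extension_eq, extensionCount]
    split_ifs <;> simp
  | succ j ih =>
    rw [ncard_symmOfRank_reindex (sumFinSuccEquivOption ι j), extensionCount]
    refine (ncard_symmOfRank_option {M : Matrix (ι ⊕ Fin j) (ι ⊕ Fin j) K | M.toBlocks₁₁ = A}
      r).trans ?_
    simp [ih, eval_finsetSum]

end Extension

section Families

variable {K E : Type*} [Field K] [AddCommGroup E] [Module K E]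

/-- The number of vectors in dimension `n` whose addition to two nested subspaces changes the
dimensions of these subspaces from `d` to `d'`, as a polynomial in the order of the field. -/
noncomputable def appendCount (n : ℕ) (d d' : ℕ × ℕ) : ℤ[X] :=
  X ^ d.1 * (if d = d' then 1 else 0) +
    (X ^ d.2 - X ^ d.1) * (if (d.1 + 1, d.2) = d' then 1 else 0) +
    (X ^ n - X ^ d.2) * (if (d.1 + 1, d.2 + 1) = d' then 1 else 0)

theorem ncard_append [Finite K] [FiniteDimensional K E] {U W : Submodule K E} (h : U ≤ W)
    (d : ℕ × ℕ) :
    ({v | (finrank K ↥(U ⊔ Submodule.span K {v}), finrank K ↥(W ⊔ Submodule.span K {v})) = d}.ncard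
      : ℤ) =
      (appendCount (finrank K E) (finrank K U, finrank K W) d).eval (Nat.card K : ℤ) := by
  classical
  have := Module.finite_of_finite K (M := E)
  cases nonempty_fintype E
  have finrank_of_mem {V : Submodule K E} {v : E} (hv : v ∈ V) :
      finrank K ↥(V ⊔ Submodule.span K {v}) = finrank K V := by
    rw [sup_eq_left.2 ((Submodule.span_singleton_le_iff_mem _ _).2 hv)]
  rw [Set.ncard_eq_toFinset_card', Set.toFinset_ofPred, Finset.natCast_card_filter,
    sum_eq_of_const_on_flag h (a := if (finrank K U, finrank K W) = d then 1 else 0)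
      (b := if (finrank K U + 1, finrank K W) = d then 1 else 0)
      (c := if (finrank K U + 1, finrank K W + 1) = d then 1 else 0), appendCount]
  · simp only [eval_add, eval_mul, eval_sub, eval_pow, eval_X, apply_ite (eval _), eval_one,
      eval_zero]
  · intro v hv
    rw [finrank_of_mem hv, finrank_of_mem (h hv)]
  · intro v hvW hvU
    rw [Submodule.finrank_sup_span_singleton hvU, finrank_of_mem hvW]
  · intro v hv
    rw [Submodule.finrank_sup_span_singleton (mt (@h v) hv),
      Submodule.finrank_sup_span_singleton hv]

/-- The number of families of `s` vectors in dimension `n` whose span, and the sum of whose span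
with a given subspace of dimension `t`, have dimensions `d.1` and `d.2`, as a polynomial in the
order of the field. -/
noncomputable def familyCount (n t : ℕ) : ℕ → ℕ × ℕ → ℤ[X]
  | 0, d => if (0, t) = d then 1 else 0
  | s + 1, d => ∑ d' ∈ Finset.range (n + 1) ×ˢ Finset.range (n + 1),
      familyCount n t s d' * appendCount n d' d

theorem ncard_families [Finite K] [FiniteDimensional K E] (T : Submodule K E) (s : ℕ)
    (d : ℕ × ℕ) :
    ({x : Fin s → E | (finrank K ↥(Submodule.span K (Set.range x)),
        finrank K ↥(Submodule.span K (Set.range x) ⊔ T)) = d}.ncard : ℤ) =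
      (familyCount (finrank K E) (finrank K T) s d).eval (Nat.card K : ℤ) := by
  have := Module.finite_of_finite K (M := E)
  induction s generalizing d with
  | zero =>
    have dims_eq (x : Fin 0 → E) : (finrank K ↥(Submodule.span K (Set.range x)),
        finrank K ↥(Submodule.span K (Set.range x) ⊔ T)) = (0, finrank K T) := by
      rw [Set.range_eq_empty, Submodule.span_empty, finrank_bot, bot_sup_eq]
    simp only [dims_eq, familyCount]
    split_ifs with h <;> simp [h]
  | succ s ih =>
    rw [ncard_eq_sum_of_ncard_fiber_eq (g := Fin.tail) (Set.mapsTo_univ _ _)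
      (ρ := fun y => (finrank K ↥(Submodule.span K (Set.range y)),
        finrank K ↥(Submodule.span K (Set.range y) ⊔ T)))
      (T := Finset.range (finrank K E + 1) ×ˢ Finset.range (finrank K E + 1))
      (fun y _ => by simp [Submodule.finrank_le])
      (c := fun d' => (appendCount (finrank K E) d' d).eval (Nat.card K : ℤ)) fun y _ => ?_]
    · simp [ih, familyCount, eval_finsetSum]
    · have span_cons (v : E) : Submodule.span K (Set.range (Fin.cons v y : Fin (s + 1) → E)) =
          Submodule.span K (Set.range y) ⊔ Submodule.span K {v} := by
        rw [Fin.range_cons, Submodule.span_insert, sup_comm]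
      rw [← ncard_append le_sup_left]
      refine congrArg Nat.cast (Set.InvOn.bijOn (f := fun x => x 0) (f' := fun v => Fin.cons v y)
        ⟨?_, fun _ _ => rfl⟩ ?_ ?_).ncard_eq
      · rintro x ⟨-, rfl⟩
        exact Fin.cons_self_tail x
      · rintro x ⟨hx, rfl⟩
        rw [Set.mem_ofPred_eq, sup_right_comm, ← span_cons, Fin.cons_self_tail]
        exact hx
      · intro v hv
        refine ⟨?_, Fin.tail_cons _ _⟩
        rw [Set.mem_ofPred_eq, span_cons, sup_right_comm]
        exact hv

theorem finrank_eq_and_finrank_sup_eq_iff [FiniteDimensional K E] {U T : Submodule K E} {k : ℕ} :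
    finrank K U = k ∧ finrank K ↥(U ⊔ T) = k ↔ finrank K U = k ∧ T ≤ U := by
  refine and_congr_right ?_
  rintro rfl
  rw [← sup_eq_left]
  exact ⟨fun h => (Submodule.eq_of_le_of_finrank_eq le_sup_left h.symm).symm,
    congrArg fun W : Submodule K E => finrank K W⟩

theorem ncard_rank_eq_and_le_span_col {V : Type*} [Finite K] [Fintype V] (T : Submodule K (V → K))
    (s k : ℕ) :
    ({F : Matrix V (Fin s) K | F.rank = k ∧ T ≤ Submodule.span K (Set.range F.col)}.ncard : ℤ) =
      (familyCount (Fintype.card V) (finrank K T) s (k, k)).eval (Nat.card K : ℤ) := by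
  rw [← finrank_fintype_fun_eq_card K, ← ncard_families]
  refine congrArg Nat.cast (Set.InvOn.bijOn (f := Matrix.col) (f' := fun y => (of y)ᵀ)
    ⟨fun _ _ => rfl, fun _ _ => rfl⟩ ?_ ?_).ncard_eq
  · intro F hF
    rwa [Set.mem_ofPred_eq, Prod.mk.injEq, finrank_eq_and_finrank_sup_eq_iff,
      ← rank_eq_finrank_span_cols]
  · intro y hy
    rwa [Set.mem_ofPred_eq, rank_eq_finrank_span_cols, ← finrank_eq_and_finrank_sup_eq_iff,
      ← Prod.mk.injEq]

theorem appendCount_eq_zero {n : ℕ} {d d' : ℕ × ℕ} (h : d.1 + 1 < d'.1 ∨ d'.2 < d.2) :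
    appendCount n d d' = 0 := by
  rw [appendCount, if_neg, if_neg, if_neg]
  · ring
  all_goals grind

theorem familyCount_eq_zero (n t s : ℕ) (d : ℕ × ℕ) (hd : s < d.1 ∨ d.2 < t) :
    familyCount n t s d = 0 := by
  induction s generalizing d with
  | zero =>
    rw [familyCount, if_neg]
    rintro rfl
    simp at hd
  | succ s ih =>
    rw [familyCount]
    refine Finset.sum_eq_zero fun d' _ => ?_
    by_cases hd' : s < d'.1 ∨ d'.2 < t
    · rw [ih d' hd', zero_mul]
    · rw [appendCount_eq_zero (by omega), mul_zero]

theorem familyCount_independent {n t s : ℕ} (hs : s ≤ t) (ht : t ≤ n) :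
    familyCount n t s (s, t) = ∏ i ∈ Finset.range s, (X ^ t - X ^ i) := by
  induction s with
  | zero => simp [familyCount]
  | succ s ih =>
    rw [familyCount, Finset.sum_eq_single (s, t), ih (by omega), Finset.prod_range_succ]
    · simp [appendCount]
    · rintro ⟨i, j⟩ - hij
      obtain h | h : (s < i ∨ j < t) ∨ (i + 1 < s + 1 ∨ t < j) := by grind
      · rw [familyCount_eq_zero n t s _ h, zero_mul]
      · rw [appendCount_eq_zero h, mul_zero]
    · simp only [Finset.mem_product, Finset.mem_range]
      omega

end Families

section Congruence

variable {K V m n : Type*}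

theorem isSymm_congruence [CommSemiring K] [Fintype n] {A : Matrix n n K} (hA : A.IsSymm)
    (B : Matrix m n K) : (B * A * Bᵀ).IsSymm := by
  rw [Matrix.IsSymm, transpose_mul, transpose_mul, hA.eq, transpose_transpose, Matrix.mul_assoc]

variable [Field K]

theorem rank_congruence_of_inverse [Fintype m] [Fintype n] {A : Matrix n n K} {B : Matrix m n K}
    {C : Matrix n m K} (h : C * (B * A * Bᵀ) * Cᵀ = A) : (B * A * Bᵀ).rank = A.rank := by
  refine le_antisymm ((rank_mul_le_left _ _).trans (rank_mul_le_right _ _)) ?_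
  conv_lhs => rw [← h]
  exact (rank_mul_le_left _ _).trans (rank_mul_le_right _ _)

theorem congruence_congruence_of_mul_eq_one [Fintype m] [Fintype n] [DecidableEq n]
    {B : Matrix m n K} {C : Matrix n m K} (hCB : C * B = 1) (A : Matrix n n K) :
    C * (B * A * Bᵀ) * Cᵀ = A := by
  calc C * (B * A * Bᵀ) * Cᵀ = (C * B) * A * (C * B)ᵀ := by
        simp only [transpose_mul, Matrix.mul_assoc]
    _ = A := by rw [hCB, transpose_one, Matrix.one_mul, Matrix.mul_one]

theorem ncard_symmOfRank_congruence [Fintype m] [Fintype n] [DecidableEq m] [DecidableEq n]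
    {g : Matrix m n K} {g' : Matrix n m K} (hgg' : g * g' = 1) (hg'g : g' * g = 1)
    (𝒳 : Set (Matrix m m K)) (r : ℕ) :
    (symmOfRank m K r ∩ 𝒳).ncard = (symmOfRank n K r ∩ {Q | g * Q * gᵀ ∈ 𝒳}).ncard := by
  have cancel := congruence_congruence_of_mul_eq_one hg'g
  have cancel' := congruence_congruence_of_mul_eq_one hgg'
  refine (Set.InvOn.bijOn (f := fun Q => g' * Q * g'ᵀ) (f' := fun Q => g * Q * gᵀ)
    ⟨fun Q _ => cancel' Q, fun Q _ => cancel Q⟩ ?_ ?_).ncard_eq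
  · rintro Q ⟨⟨hQ, rfl⟩, hQ𝒳⟩
    refine ⟨⟨isSymm_congruence hQ g', rank_congruence_of_inverse (cancel' Q)⟩, ?_⟩
    rwa [Set.mem_ofPred_eq, cancel']
  · rintro Q ⟨⟨hQ, rfl⟩, hQ𝒳⟩
    exact ⟨⟨isSymm_congruence hQ g, rank_congruence_of_inverse (cancel Q)⟩, hQ𝒳⟩

theorem exists_basis_adapted_ker {E E' : Type*} [AddCommGroup E] [Module K E] [AddCommGroup E']
    [Module K E'] [FiniteDimensional K E] (f : E →ₗ[K] E') {r s : ℕ}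
    (hr : finrank K (LinearMap.range f) = r) (hs : finrank K (LinearMap.ker f) = s) :
    ∃ b : Basis (Fin r ⊕ Fin s) K E,
      LinearIndependent K (fun i => f (b (Sum.inl i))) ∧ ∀ j, f (b (Sum.inr j)) = 0 := by
  obtain ⟨C, hC⟩ := Submodule.exists_isCompl (LinearMap.ker f)
  have finrank_C : finrank K C = r := by
    have h₁ := f.finrank_range_add_finrank_ker
    have h₂ := Submodule.finrank_add_eq_of_isCompl hC
    omega
  have ker_comp_subtype : LinearMap.ker (f ∘ₗ C.subtype) = ⊥ := by
    rw [LinearMap.ker_comp, ← Submodule.disjoint_iff_comap_eq_bot]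
    exact hC.disjoint.symm
  let bC := finBasisOfFinrankEq K C finrank_C
  let bker := finBasisOfFinrankEq K (LinearMap.ker f) hs
  refine ⟨(bC.prod bker).map (Submodule.prodEquivOfIsCompl C _ hC.symm), ?_, fun j => ?_⟩
  · simpa [Function.comp_def] using bC.linearIndependent.map' _ ker_comp_subtype
  · simp

theorem exists_left_inverse_of_linearIndependent_col [Fintype m] [Finite n] [DecidableEq n]
    {A : Matrix m n K} (hA : LinearIndependent K A.col) : ∃ L : Matrix n m K, L * A = 1 := by
  classical
  cases nonempty_fintype n
  obtain ⟨l, hl⟩ := A.mulVecLin.exists_leftInverse_of_injective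
    (LinearMap.ker_eq_bot.2 (mulVec_injective_iff.2 hA))
  refine ⟨LinearMap.toMatrix' l, ?_⟩
  rw [← LinearMap.toMatrix'_toLin' A, toLin'_apply', ← LinearMap.toMatrix'_comp, hl,
    LinearMap.toMatrix'_id]

theorem exists_column_reduction [Fintype V] [Fintype n] [DecidableEq n] {F : Matrix V n K} {k : ℕ}
    (hF : F.rank = k) :
    ∃ (g : Matrix n (Fin k ⊕ Fin (Fintype.card n - k)) K)
      (g' : Matrix (Fin k ⊕ Fin (Fintype.card n - k)) n K)
      (F₁ : Matrix V (Fin k) K) (L : Matrix (Fin k) V K),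
      g * g' = 1 ∧ g' * g = 1 ∧ F * g = fromCols F₁ 0 ∧ L * F₁ = 1 := by
  have finrank_ker : finrank K (LinearMap.ker F.mulVecLin) = Fintype.card n - k := by
    rw [← finrank_fintype_fun_eq_card K, ← F.mulVecLin.finrank_range_add_finrank_ker, ← hF]
    exact (Nat.add_sub_cancel_left ..).symm
  obtain ⟨b, hb_inl, hb_inr⟩ := exists_basis_adapted_ker F.mulVecLin hF finrank_ker
  obtain ⟨L, hL⟩ := exists_left_inverse_of_linearIndependent_col
    (A := (of fun i => F *ᵥ b (Sum.inl i))ᵀ) hb_inl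
  refine ⟨(Pi.basisFun K n).toMatrix b, b.toMatrix (Pi.basisFun K n), _, L,
    Basis.toMatrix_mul_toMatrix_flip _ _, Basis.toMatrix_mul_toMatrix_flip _ _, ?_, hL⟩
  ext v (i | j)
  · rfl
  · exact congrFun (hb_inr j) v

theorem span_col_le_iff_exists_eq_mul [Fintype n] {F : Matrix V n K} {P : Matrix V m K} :
    Submodule.span K (Set.range P.col) ≤ Submodule.span K (Set.range F.col) ↔
      ∃ Z : Matrix n m K, P = F * Z := by
  simp only [Submodule.span_le, Set.range_subset_iff, SetLike.mem_coe, mem_span_range_col_iff]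
  constructor
  · intro h
    choose z hz using h
    refine ⟨(of z)ᵀ, ?_⟩
    ext i j
    exact (congrFun (hz j) i).symm
  · rintro ⟨Z, rfl⟩ j
    exact ⟨Z.col j, rfl⟩

theorem fromCols_zero_congruence {n₁ n₂ : Type*} [Fintype n₁] [Fintype n₂] (F₁ : Matrix V n₁ K)
    (Q : Matrix (n₁ ⊕ n₂) (n₁ ⊕ n₂) K) :
    fromCols F₁ (0 : Matrix V n₂ K) * Q * (fromCols F₁ (0 : Matrix V n₂ K))ᵀ =
      F₁ * Q.toBlocks₁₁ * F₁ᵀ := by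
  conv_lhs => rw [← fromBlocks_toBlocks Q, transpose_fromCols, fromCols_mul_fromBlocks,
    fromCols_mul_fromRows]
  simp

theorem ncard_symmOfRank_congruence_eq [Finite K] [Fintype V] [Fintype n] {F : Matrix V n K}
    {k : ℕ} (hF : F.rank = k) {P : Matrix V V K} (hP : P.IsSymm)
    (hPF : Submodule.span K (Set.range P.col) ≤ Submodule.span K (Set.range F.col)) (r : ℕ) :
    ((symmOfRank n K r ∩ {Q | F * Q * Fᵀ = P}).ncard : ℤ) =
      (extensionCount k P.rank (Fintype.card n - k) r).eval (Nat.card K : ℤ) := by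
  classical
  obtain ⟨g, g', F₁, L, hgg', hg'g, hFg, hL⟩ := exists_column_reduction hF
  obtain ⟨Z, hZ⟩ := span_col_le_iff_exists_eq_mul.1 hPF
  have factorization : F = F₁ * g'.toRows₁ := by
    rw [← Matrix.mul_one F, ← hgg', ← Matrix.mul_assoc, hFg, ← fromRows_toRows g',
      fromCols_mul_fromRows]
    simp
  have proj : F₁ * L * P = P := by
    rw [hZ, factorization, ← Matrix.mul_assoc, ← Matrix.mul_assoc, Matrix.mul_assoc F₁ L F₁, hL,
      Matrix.mul_one]
  have lift_congruence : F₁ * (L * P * Lᵀ) * F₁ᵀ = P := by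
    calc F₁ * (L * P * Lᵀ) * F₁ᵀ = F₁ * L * (F₁ * L * P)ᵀ := by
          simp only [transpose_mul, Matrix.mul_assoc, hP.eq]
      _ = P := by rw [proj, hP.eq, proj]
  have block_iff
      (Q : Matrix (Fin k ⊕ Fin (Fintype.card n - k)) (Fin k ⊕ Fin (Fintype.card n - k)) K) :
      F * (g * Q * gᵀ) * Fᵀ = P ↔ Q.toBlocks₁₁ = L * P * Lᵀ := by
    have : F * (g * Q * gᵀ) * Fᵀ = F₁ * Q.toBlocks₁₁ * F₁ᵀ := by
      rw [← fromCols_zero_congruence, ← hFg]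
      simp only [transpose_mul, Matrix.mul_assoc]
    rw [this]
    refine ⟨fun h => ?_, fun h => h ▸ lift_congruence⟩
    rw [← h, congruence_congruence_of_mul_eq_one hL]
  rw [ncard_symmOfRank_congruence hgg' hg'g]
  simp only [Set.mem_ofPred_eq, block_iff]
  rw [ncard_symmOfRank_extension (isSymm_congruence hP L),
    rank_congruence_of_inverse lift_congruence, Fintype.card_fin]

theorem ncard_congruence_pairs [Finite K] [Fintype V] {P : Matrix V V K} (hP : P.IsSymm)
    (s r k : ℕ) :
    ({x : Matrix (Fin s) (Fin s) K × Matrix V (Fin s) K |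
        x.1 ∈ symmOfRank (Fin s) K r ∧ x.2.rank = k ∧ x.2 * x.1 * x.2ᵀ = P}.ncard : ℤ) =
      (familyCount (Fintype.card V) P.rank s (k, k) *
        extensionCount k P.rank (s - k) r).eval (Nat.card K : ℤ) := by
  rw [eval_mul, rank_eq_finrank_span_cols P, ← ncard_rank_eq_and_le_span_col,
    ← rank_eq_finrank_span_cols P]
  refine ncard_eq_ncard_mul_of_ncard_fiber_eq (g := Prod.snd) ?_ ?_
  · rintro ⟨Q, F⟩ ⟨-, hF, hQF⟩
    exact ⟨hF, span_col_le_iff_exists_eq_mul.2 ⟨Q * Fᵀ, by rw [← Matrix.mul_assoc, hQF]⟩⟩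
  · rintro F ⟨hF, hPF⟩
    have count := ncard_symmOfRank_congruence_eq hF hP hPF r
    rw [Fintype.card_fin] at count
    rw [← count]
    refine congrArg Nat.cast (Set.InvOn.bijOn (f := Prod.fst) (f' := fun Q => (Q, F))
      ⟨?_, fun _ _ => rfl⟩ ?_ ?_).ncard_eq
    · rintro ⟨Q, F⟩ ⟨-, rfl⟩
      rfl
    · rintro ⟨Q, F⟩ ⟨⟨hQ, -, hQF⟩, rfl⟩
      exact ⟨hQ, hQF⟩
    · rintro Q ⟨hQ, hQF⟩
      exact ⟨⟨hQ, hF, hQF⟩, rfl⟩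

end Congruence

section Points

variable {V W K : Type*}

/-- The matrices over `K`, with rows and columns indexed by the vertices of `Γ`, whose `(v, w)`
entry is zero whenever `v` and `w` are joined by an edge. -/
def vanishingOnEdges (Γ : SimpleGraph V) (K : Type*) [Zero K] : Set (Matrix V V K) :=
  {M | ∀ v w, Γ.Adj v w → M v w = 0}

theorem mem_vanishingOnEdges_map [Zero K] {Γ : SimpleGraph V} (e : V ↪ W) {M : Matrix W W K} :
    M ∈ vanishingOnEdges (Γ.map e) K ↔ M.submatrix e e ∈ vanishingOnEdges Γ K := by
  constructor
  · exact fun h v w hvw => h _ _ ((SimpleGraph.map_adj _ _ _ _).2 ⟨v, w, hvw, rfl, rfl⟩)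
  · intro h v w hvw
    obtain ⟨v', w', hvw', rfl, rfl⟩ := (SimpleGraph.map_adj _ _ _ _).1 hvw
    exact h v' w' hvw'

theorem finrank_range_toBilin' {n : Type*} [Field K] [Fintype n] [DecidableEq n]
    (A : Matrix n n K) : finrank K (LinearMap.range (Matrix.toBilin' A)) = A.rank := by
  have ker_eq : LinearMap.ker (Matrix.toBilin' A) = LinearMap.ker Aᵀ.mulVecLin := by
    ext x
    simp only [LinearMap.mem_ker, mulVecLin_apply, mulVec_transpose, LinearMap.ext_iff,
      Matrix.toBilin'_apply', LinearMap.zero_apply, dotProduct_mulVec, dotProduct_eq_zero_iff]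
  have rank_nullity := (Matrix.toBilin' A).finrank_range_add_finrank_ker
  have rank_nullity_transpose := Aᵀ.mulVecLin.finrank_range_add_finrank_ker
  rw [ker_eq] at rank_nullity
  rw [← rank_transpose A, Matrix.rank]
  omega

theorem mul_mul_transpose_apply_eq_toBilin' {n : Type*} [CommSemiring K] [Fintype n]
    [DecidableEq n] (F : Matrix V n K) (Q : Matrix n n K) (v w : V) :
    (F * Q * Fᵀ) v w = Matrix.toBilin' Q (F v) (F w) := by
  rw [Matrix.toBilin'_apply', dotProduct_mulVec]
  rfl

theorem ncard_APoints_eq_ncard_pairs (G : FinSimpleGraph.{u}) (s r k : ℕ) (K : Type) [Field K] :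
    (APoints G s r k K).ncard =
      {x : Matrix (Fin s) (Fin s) K × Matrix G.V (Fin s) K | x.1 ∈ symmOfRank (Fin s) K r ∧
        x.2.rank = k ∧ x.2 * x.1 * x.2ᵀ ∈ vanishingOnEdges G.graph K}.ncard := by
  let e : Matrix (Fin s) (Fin s) K × Matrix G.V (Fin s) K ≃
      LinearMap.BilinForm K (Fin s → K) × (G.V → Fin s → K) :=
    Equiv.prodCongr Matrix.toBilin'.toEquiv Matrix.of.symm
  rw [← Set.ncard_preimage_of_injective_subset_range (s := APoints G s r k K) e.injective
    (by simp [e.range_eq_univ])]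
  congr 1
  ext ⟨Q, F⟩
  change (Matrix.toBilin' Q).IsSymm ∧ finrank K (LinearMap.range (Matrix.toBilin' Q)) = r ∧
      finrank K (Submodule.span K (Set.range F.row)) = k ∧
      (∀ v w, G.graph.Adj v w → Matrix.toBilin' Q (F v) (F w) = 0) ↔
    (Q.IsSymm ∧ Q.rank = r) ∧ F.rank = k ∧ ∀ v w, G.graph.Adj v w → (F * Q * Fᵀ) v w = 0
  simp only [Matrix.isSymm_toBilin'_iff_isSymm, finrank_range_toBilin', rank_eq_finrank_span_row,
    mul_mul_transpose_apply_eq_toBilin', and_assoc]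

theorem ncard_APoints (G : FinSimpleGraph.{u}) (s r k : ℕ) (K : Type) [Field K] [Finite K] :
    ((APoints G s r k K).ncard : ℤ) = ∑ t ∈ Finset.range (Fintype.card G.V + 1),
      ((symmOfRank G.V K t ∩ vanishingOnEdges G.graph K).ncard : ℤ) *
        (familyCount (Fintype.card G.V) t s (k, k) * extensionCount k t (s - k) r).eval
          (Nat.card K : ℤ) := by
  rw [ncard_APoints_eq_ncard_pairs]
  refine ncard_eq_sum_ncard_symmOfRank (g := fun x => x.2 * x.1 * x.2ᵀ)
    (c := fun t => (familyCount _ t s (k, k) * extensionCount k t (s - k) r).eval _)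
    (fun x hx => ⟨isSymm_congruence hx.1.1 x.2, hx.2.2⟩) fun P hP hPs => ?_
  rw [← ncard_congruence_pairs hPs]
  congr 2
  ext x
  constructor
  · rintro ⟨⟨hQ, hF, -⟩, rfl⟩
    exact ⟨hQ, hF, rfl⟩
  · rintro ⟨hQ, hF, rfl⟩
    exact ⟨⟨hQ, hF, hP⟩, rfl⟩

end Points

section Localization

theorem evalHom_apply (p : ℤ[X]) (q : PrimePower) :
    evalHom p q = ((p.eval (Nat.card (Fq q) : ℤ) : ℤ) : ℚ) := by
  rw [card_Fq]
  exact (eval₂_at_natCast (Int.castRingHom ℚ) q.1 : p.eval₂ _ _ = _)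

theorem algebraMap_algebraMap_eq (p : ℤ[X]) :
    algebraMap R CountFun (algebraMap ℤ[X] R p) = evalHom p :=
  IsLocalization.lift_eq isUnit_evalHom p

theorem evalHom_mul_mem {N : Submodule R CountFun} {F : CountFun} (hF : F ∈ N) (p : ℤ[X]) :
    evalHom p * F ∈ N := by
  rw [← algebraMap_algebraMap_eq, ← Algebra.smul_def]
  exact N.smul_mem _ hF

theorem mem_of_evalHom_mul_mem {N : Submodule R CountFun} {F : CountFun} {p : ℤ[X]} (hp : p ∈ S)
    (hF : evalHom p * F ∈ N) : F ∈ N := by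
  rw [← algebraMap_algebraMap_eq, ← Algebra.smul_def] at hF
  exact (N.smul_mem_iff_of_isUnit (IsLocalization.map_units R ⟨p, hp⟩)).1 hF

theorem mem_S_of_dvd {f : ℤ[X]} {n : ℕ} (hn : 1 < n) (h : f ∣ X ^ n - X) : f ∈ S := by
  obtain ⟨g, hg⟩ := h
  refine Submonoid.mem_saturation_iff.mpr ⟨g, ?_⟩
  rw [← hg]
  exact Submonoid.subset_closure ⟨n, hn, rfl⟩

theorem X_mem_S : (X : ℤ[X]) ∈ S :=
  mem_S_of_dvd one_lt_two ⟨X - 1, by ring⟩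

theorem X_pow_sub_X_pow_mem_S {t n : ℕ} (h : t < n) : (X ^ n - X ^ t : ℤ[X]) ∈ S := by
  obtain ⟨m, rfl⟩ := Nat.exists_eq_add_of_lt h
  have factor : (X ^ (t + m + 1) - X ^ t : ℤ[X]) = X ^ t * (X ^ (m + 1) - 1) := by ring
  rw [factor]
  exact mul_mem (pow_mem X_mem_S t) (mem_S_of_dvd (n := m + 2) (by omega) ⟨X, by ring⟩)

end Localization

section CountingModules

/-- The function `q ↦` number of symmetric matrices of rank `t` over `𝔽_q` vanishing on the edges
of `G`; the counting functions of the theorem are all combinations of these. -/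
noncomputable def countRank (G : FinSimpleGraph.{u}) (t : ℕ) : CountFun :=
  fun q => ((symmOfRank G.V (Fq q) t ∩ vanishingOnEdges G.graph (Fq q)).ncard : ℚ)

theorem countRank_eq_zero {G : FinSimpleGraph.{u}} {t : ℕ} (ht : Fintype.card G.V < t) :
    countRank G t = 0 := by
  funext q
  have no_matrix : symmOfRank G.V (Fq q) t = ∅ :=
    Set.eq_empty_of_forall_notMem fun A hA => ht.not_ge (hA.2 ▸ A.rank_le_card_width)
  simp [countRank, no_matrix]

theorem countZ_eq_countRank (G : FinSimpleGraph.{u}) :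
    countZ G = countRank G (Fintype.card G.V) := by
  funext q
  rw [countZ, countRank, Nat.card_coe_set_eq]
  congr 2
  ext A
  exact and_assoc.symm

theorem countA_eq_sum (G : FinSimpleGraph.{u}) (s r k : ℕ) :
    countA G s r k = ∑ t ∈ Finset.range (Fintype.card G.V + 1),
      evalHom (familyCount (Fintype.card G.V) t s (k, k) * extensionCount k t (s - k) r) *
        countRank G t := by
  funext q
  have h := congrArg (Int.cast : ℤ → ℚ) (ncard_APoints G s r k (Fq q))
  push_cast at h
  rw [countA, Nat.card_coe_set_eq, h, Finset.sum_apply]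
  refine Finset.sum_congr rfl fun t _ => ?_
  rw [Pi.mul_apply, evalHom_apply, mul_comm, countRank]

theorem card_D (G : FinSimpleGraph.{u}) : Fintype.card (D G).V = Fintype.card G.V + 1 := by
  rw [← Nat.card_eq_fintype_card, ← Nat.card_eq_fintype_card]
  exact Finite.card_option

theorem countRank_D (G : FinSimpleGraph.{u}) (r : ℕ) :
    countRank (D G) r = ∑ t ∈ Finset.range (Fintype.card G.V + 1),
      evalHom (borderCount (Fintype.card G.V) t r) * countRank G t := by
  funext q
  have points_D : symmOfRank (D G).V (Fq q) r ∩ vanishingOnEdges (D G).graph (Fq q) =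
      symmOfRank (Option G.V) (Fq q) r ∩
        {A | A.submatrix some some ∈ vanishingOnEdges G.graph (Fq q)} := by
    ext A
    refine and_congr (and_congr Iff.rfl ?_) (mem_vanishingOnEdges_map Function.Embedding.some)
    exact Eq.congr (by congr!) rfl
  have h := congrArg (Int.cast : ℤ → ℚ)
    (ncard_symmOfRank_option (vanishingOnEdges G.graph (Fq q)) r)
  push_cast at h
  refine (congrArg (fun 𝒳 => (𝒳.ncard : ℚ)) points_D).trans (h.trans ?_)
  rw [Finset.sum_apply]
  refine Finset.sum_congr rfl fun t _ => ?_
  rw [Pi.mul_apply, evalHom_apply, mul_comm, countRank]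

/-- The module generated by the functions `countRank G t`. -/
noncomputable def rankModule (G : FinSimpleGraph.{u}) : Submodule R CountFun :=
  Submodule.span R (Set.range (countRank G))

/-- The module generated by the functions `[Z_{D^k G}]`. -/
noncomputable def iterateModule (G : FinSimpleGraph.{u}) : Submodule R CountFun :=
  Submodule.span R (Set.range fun k : ℕ => countZ (D^[k] G))

theorem countRank_mem_rankModule (G : FinSimpleGraph.{u}) (t : ℕ) :
    countRank G t ∈ rankModule G :=
  Submodule.subset_span ⟨t, rfl⟩

theorem M_le_rankModule (G : FinSimpleGraph.{u}) : M G ≤ rankModule G := by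
  refine Submodule.span_le.2 ?_
  rintro _ ⟨s, r, k, rfl⟩
  rw [SetLike.mem_coe, countA_eq_sum]
  exact Submodule.sum_mem _ fun t _ => evalHom_mul_mem (countRank_mem_rankModule G t) _

theorem countRank_mem_M {G : FinSimpleGraph.{u}} {t : ℕ} (ht : t ≤ Fintype.card G.V) :
    countRank G t ∈ M G := by
  have countA_eq : countA G t t t =
      evalHom (∏ i ∈ Finset.range t, (X ^ t - X ^ i)) * countRank G t := by
    rw [countA_eq_sum, Finset.sum_eq_single_of_mem t (Finset.mem_range_succ_iff.2 ht)]
    · rw [familyCount_independent le_rfl ht, Nat.sub_self, extensionCount, if_pos rfl, mul_one]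
    · intro t' _ ht'
      rw [Nat.sub_self, extensionCount, if_neg ht', mul_zero, map_zero, zero_mul]
  have countA_mem : countA G t t t ∈ M G := Submodule.subset_span ⟨t, t, t, rfl⟩
  rw [countA_eq] at countA_mem
  exact mem_of_evalHom_mul_mem
    (prod_mem fun i hi => X_pow_sub_X_pow_mem_S (Finset.mem_range.1 hi)) countA_mem

theorem rankModule_le_of_countRank_mem {G : FinSimpleGraph.{u}} {N : Submodule R CountFun}
    (h : ∀ t ≤ Fintype.card G.V, countRank G t ∈ N) : rankModule G ≤ N := by
  refine Submodule.span_le.2 ?_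
  rintro _ ⟨t, rfl⟩
  rcases le_or_gt t (Fintype.card G.V) with ht | ht
  · exact h t ht
  · exact countRank_eq_zero ht ▸ N.zero_mem

theorem M_eq_rankModule (G : FinSimpleGraph.{u}) : M G = rankModule G :=
  (M_le_rankModule G).antisymm (rankModule_le_of_countRank_mem fun _ => countRank_mem_M)

theorem rankModule_D_le (G : FinSimpleGraph.{u}) : rankModule (D G) ≤ rankModule G := by
  refine rankModule_le_of_countRank_mem fun r _ => ?_
  rw [countRank_D]
  exact Submodule.sum_mem _ fun t _ => evalHom_mul_mem (countRank_mem_rankModule G t) _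

theorem iterateModule_D_le (G : FinSimpleGraph.{u}) : iterateModule (D G) ≤ iterateModule G := by
  refine Submodule.span_mono ?_
  rintro _ ⟨k, rfl⟩
  exact ⟨k + 1, rfl⟩

theorem iterateModule_le_rankModule (G : FinSimpleGraph.{u}) :
    iterateModule G ≤ rankModule G := by
  refine Submodule.span_le.2 ?_
  rintro _ ⟨k, rfl⟩
  change countZ (D^[k] G) ∈ rankModule G
  induction k generalizing G with
  | zero => exact countZ_eq_countRank G ▸ countRank_mem_rankModule G _
  | succ k ih => exact rankModule_D_le G (ih (D G))

theorem countRank_mem_of_countRank_D_mem {G : FinSimpleGraph.{u}} {N : Submodule R CountFun}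
    {t : ℕ} (ht : t < Fintype.card G.V) (hD : countRank (D G) (t + 2) ∈ N)
    (hN : ∀ t', t < t' → t' ≤ Fintype.card G.V → countRank G t' ∈ N) : countRank G t ∈ N := by
  have higher_ranks_mem : ∑ t' ∈ (Finset.range (Fintype.card G.V + 1)).erase t,
      evalHom (borderCount (Fintype.card G.V) t' (t + 2)) * countRank G t' ∈ N := by
    refine Submodule.sum_mem _ fun t' ht' => ?_
    rw [Finset.mem_erase, Finset.mem_range_succ_iff] at ht'
    rcases lt_or_gt_of_ne ht'.1 with h | h
    · rw [borderCount_eq_zero (by omega), map_zero, zero_mul]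
      exact zero_mem _
    · exact evalHom_mul_mem (hN t' h ht'.2) _
  rw [countRank_D, ← Finset.add_sum_erase _ _ (Finset.mem_range_succ_iff.2 ht.le),
    Submodule.add_mem_iff_left _ higher_ranks_mem, borderCount_add_two] at hD
  exact mem_of_evalHom_mul_mem (mul_mem (X_pow_sub_X_pow_mem_S ht) X_mem_S) hD

theorem countRank_mem_iterateModule {G : FinSimpleGraph.{u}} {t : ℕ}
    (ht : t ≤ Fintype.card G.V) : countRank G t ∈ iterateModule G := by
  -- Passing from `(G, t)` to `(D G, t + 2)` lowers the corank by one.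
  induction d : Fintype.card G.V - t using Nat.strong_induction_on generalizing G t with
  | _ d ih =>
    rcases ht.eq_or_lt with rfl | ht
    · exact Submodule.subset_span ⟨0, countZ_eq_countRank G⟩
    · have card_D_eq := card_D G
      refine countRank_mem_of_countRank_D_mem ht
        (iterateModule_D_le G (ih _ ?_ ?_ rfl)) fun t' htt' ht' => ih _ ?_ ht' rfl
      all_goals omega

theorem iterateModule_eq_rankModule (G : FinSimpleGraph.{u}) : iterateModule G = rankModule G :=
  (iterateModule_le_rankModule G).antisymm
    (rankModule_le_of_countRank_mem fun _ => countRank_mem_iterateModule)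

theorem iterateModule_le_GraphsStar (G : FinSimpleGraph.{u}) :
    iterateModule G ≤ GraphsStar.{u} := by
  refine Submodule.span_mono ?_
  rintro _ ⟨k, rfl⟩
  exact ⟨_, rfl⟩

end CountingModules

end GraphModules

theorem mainTheorem6 (G : GraphModules.FinSimpleGraph.{u}) :
    GraphModules.M G = Submodule.span GraphModules.R
        (Set.range fun k : ℕ => GraphModules.countZ (GraphModules.D^[k] G)) ∧
      GraphModules.M G ≤ GraphModules.GraphsStar.{u} := by
  have M_eq : GraphModules.M G = GraphModules.iterateModule G :=
    (GraphModules.M_eq_rankModule G).trans (GraphModules.iterateModule_eq_rankModule G).symm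
  exact ⟨M_eq, M_eq.le.trans (GraphModules.iterateModule_le_GraphsStar G)⟩
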